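/- Let $\mathbb{R}^N$ and $\mathbb{R}^n$ carry arbitrary fixed norms. Write $\mathbb{Z}_-=\{\dots,-2,-1,0\}$ and let $\ell^\infty_-(\mathbb{R}^m)$ be the Banach space of bounded sequences $\mathbf{z}=(\mathbf{z}_t)_{t\in\mathbb{Z}_-}$ in $\mathbb{R}^m$ with norm $\|\mathbf{z}\|_\infty=\sup_{t\le 0}\|\mathbf{z}_t\|$. For $k\ge 0$ let $(T_k\mathbf{z})_t:=\mathbf{z}_{t-k}$, and call a set $V\subset \ell^\infty_-(\mathbb{R}^m)$ time-invariant if $T_k(V)=V$ for all $k\ge 0$. Let $F:\mathbb{R}^N\times\mathbb{R}^n\to\mathbb{R}^N$ be real analytic (that is, given near each point by a convergent power series), with $$\sup_{(\mathbf{x},\mathbf{z})\in\mathbb{R}^N\times\mathbb{R}^n}\|D^rF(\mathbf{x},\mathbf{z})\|<\infty\quad\text{for every } r\ge 1.$$ Let $(\mathbf{x}^0,\mathbf{z}^0)\in\mathbb{R}^N\times\mathbb{R}^n$ satisfy $\mathbf{x}^0=F(\mathbf{x}^0,\mathbf{z}^0)$ and $\|D_xF(\mathbf{x}^0,\mathbf{z}^0)\|<1$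 (operator norm), and denote the associated constant sequences by the same symbols. Then there exist open time-invariant neighbourhoods $V_{\mathbf{x}^0}\subset\ell^\infty_-(\mathbb{R}^N)$ of $\mathbf{x}^0$ and $V_{\mathbf{z}^0}\subset\ell^\infty_-(\mathbb{R}^n)$ of $\mathbf{z}^0$ such that: 1. (Echo state property) for every $\mathbf{z}\in V_{\mathbf{z}^0}$ there is exactly one $\mathbf{x}\in V_{\mathbf{x}^0}$ with $\mathbf{x}_t=F(\mathbf{x}_{t-1},\mathbf{z}_t)$ for all $t\in\mathbb{Z}_-$. 2. There is consequently a unique map $U^F:V_{\mathbf{z}^0}\to V_{\mathbf{x}^0}$ such that $U^F(\mathbf{z})_t=F(U^F(\mathbf{z})_{t-1},\mathbf{z}_t)$ for all $\mathbf{z}\in V_{\mathbf{z}^0}$ and $t\in\mathbb{Z}_-$. It is causal (if $\mathbf{z},\mathbf{w}\in V_{\mathbf{z}^0}$ agree at all times $\le t$, then $U^F(\mathbf{z})_t=U^F(\mathbf{w})_t$), time-invariant ($U^F(T_k\mathbf{z})=T_k U^F(\mathbf{z})$ for all $k\ge0$, $\mathbf{z}\in V_{\mathbf{z}^0}$), and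 analytic, hence continuous, with respect to the supremum norms on both sides; moreover its Taylor series at each point of $V_{\mathbf{z}^0}$ converges to $U^F$ on all of $V_{\mathbf{z}^0}$. -/

import Mathlib

open Set
open scoped ENNReal

noncomputable section

/-- The index set `ℤ₋ = {…, -2, -1, 0}`. -/
abbrev NegInt : Type := {t : ℤ // t ≤ 0}

/-- The time `t - k`, for `t ∈ ℤ₋` and `k ∈ ℕ`. -/
def NegInt.back (k : ℕ) (t : NegInt) : NegInt :=
  ⟨t.1 - k, by have := t.2; omega⟩

/-- The Banach space `ℓ₋^∞(E)` of bounded left semi-infinite sequences with values in `E`, with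
the norm `‖z‖ = sup_{t ≤ 0} ‖z t‖`. -/
abbrev LInfMinus (E : Type*) [NormedAddCommGroup E] : Type _ :=
  lp (fun _ : NegInt => E) ∞

section
variable {E G : Type*} [NormedAddCommGroup E] [NormedAddCommGroup G]

/-- The constant sequence with value `v`. -/
def constSeq (v : E) : LInfMinus E :=
  ⟨fun _ => v, memℓp_infty ⟨‖v‖, by rintro _ ⟨_, rfl⟩; exact le_rfl⟩⟩

/-- The time delay operator on left semi-infinite sequences, `(delay k z) t = z (t - k)`. -/
def delay (k : ℕ) (z : LInfMinus E) : LInfMinus E :=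
  ⟨fun t => z (t.back k), memℓp_infty ⟨‖z‖, by
    rintro _ ⟨t, rfl⟩; exact lp.norm_apply_le_norm ENNReal.top_ne_zero z (t.back k)⟩⟩

/-- A set of left semi-infinite sequences is time-invariant when each delay operator maps it
onto itself. -/
def IsTimeInvariantSet (V : Set (LInfMinus E)) : Prop :=
  ∀ k : ℕ, delay k '' V = V

/-- `x` is a solution, for the input `z`, of the reservoir system
`x t = F (x (t - 1), z t)`, `t ∈ ℤ₋`. -/
def IsReservoirSolution (F : E × G → E) (x : LInfMinus E) (z : LInfMinus G) : Prop :=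
  ∀ t : NegInt, x t = F (x (t.back 1), z t)

/-- The echo state property with inputs in `Vz` and states in `Vx`: each input in `Vz` has exactly
one solution in `Vx`. -/
def HasESP (F : E × G → E) (Vz : Set (LInfMinus G)) (Vx : Set (LInfMinus E)) : Prop :=
  ∀ z ∈ Vz, ∃! x : LInfMinus E, x ∈ Vx ∧ IsReservoirSolution F x z

/-- `U` (only its values on `Vz` matter) is a reservoir filter `Vz → Vx` of the system of `F`. -/
def IsReservoirFilter (F : E × G → E) (Vz : Set (LInfMinus G)) (Vx : Set (LInfMinus E))
    (U : LInfMinus G → LInfMinus E) : Prop :=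
  MapsTo U Vz Vx ∧ ∀ z ∈ Vz, IsReservoirSolution F (U z) z

/-- Causality on `V`: the output at time `t` depends only on the input up to time `t`. -/
def IsCausalOn (U : LInfMinus G → LInfMinus E) (V : Set (LInfMinus G)) : Prop :=
  ∀ z ∈ V, ∀ w ∈ V, ∀ t : NegInt, (∀ s : NegInt, s ≤ t → z s = w s) → U z t = U w t

/-- A time-invariant filter on `V`: `V` is time-invariant and `U` commutes with the delays. -/
def IsTimeInvariantFilterOn (U : LInfMinus G → LInfMinus E) (V : Set (LInfMinus G)) : Prop :=
  IsTimeInvariantSet V ∧ ∀ k : ℕ, ∀ z ∈ V, U (delay k z) = delay k (U z)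

end

/-- The power series of `f` at each point `c` of `V` exists, and it converges to `f` on all
of `V`, not only near `c`. -/
def HasPowerSeriesThroughout {X Y : Type*} [NormedAddCommGroup X] [NormedSpace ℝ X]
    [NormedAddCommGroup Y] [NormedSpace ℝ Y] (f : X → Y) (V : Set X) : Prop :=
  ∀ c ∈ V, ∃ p : FormalMultilinearSeries ℝ X Y, HasFPowerSeriesAt f p c ∧
    ∀ u ∈ V, HasSum (fun k : ℕ => p k fun _ => u - c) (f u)

end

/-!
The state equation is solved in `ℓ^∞` by the analytic implicit function theorem.

Write the equation as `Ψ (z, x) = x - N (S (z, x)) = 0`, where `S (z, x) t = (x (t - 1), z t)` is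
linear and `N` is the superposition operator `(N w) t = F (w t)`. Near the constant sequence `c`
with value `(x₀, z₀)` the operator `N` is analytic: if `p` is the power series of `F` at `(x₀, z₀)`,
then applying each `p n` at every time gives continuous multilinear maps on `ℓ^∞` of no larger
norm, hence a power series with positive radius, and its sum is `N`
(`exists_analyticAt_superposition`). The partial derivative of `Ψ` in `x` is `1 - T`, where
`(T x) t = D_xF(x₀, z₀) (x (t - 1))` has norm less than `1`, so it is invertible. The implicit
function theorem then yields an analytic `ψ` such that, for `(z, x)` near the constant sequences,
`x` is a solution for the input `z` if and only if `x = ψ z`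
(`exists_analyticAt_forall_isReservoirSolution_iff`).

Balls centred at constant sequences are time-invariant, and on small enough balls the equivalence
above contains existence and uniqueness at once. Time-invariance of `ψ` follows from uniqueness, as
the delay of a solution solves the delayed equation; causality follows from time-invariance, since
`ψ z t` is the value at time `0` of the delayed output. Finally, if the power series of `ψ` at the
centre converges on a ball of radius `r`, the one at a point `c` at distance less than `r / 3` from
the centre converges on the ball of radius `2 r / 3` about `c`, which contains the ball of radius
`r / 3` about the centre (`HasFPowerSeriesOnBall.hasPowerSeriesThroughout_ball`).
-/

section
variable {X Y : Type*} [NormedAddCommGroup X] [NormedAddCommGroup Y]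

/-! ### Bounded sequences and delays -/

@[simp] lemma constSeq_apply (v : X) (t : NegInt) : constSeq v t = v := rfl

@[simp] lemma delay_apply (k : ℕ) (z : LInfMinus X) (t : NegInt) :
    delay k z t = z (t.back k) := rfl

lemma norm_delay_le (k : ℕ) (z : LInfMinus X) : ‖delay k z‖ ≤ ‖z‖ :=
  lp.norm_le_of_forall_le (norm_nonneg _) fun t =>
    lp.norm_apply_le_norm ENNReal.top_ne_zero z (t.back k)

lemma NegInt.back_back (k l : ℕ) (t : NegInt) : (t.back k).back l = (t.back l).back k :=
  Subtype.ext (by simp only [NegInt.back]; ring)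

lemma delay_mem_ball_constSeq {v : X} {ε : ℝ} {z : LInfMinus X}
    (hz : z ∈ Metric.ball (constSeq v) ε) (k : ℕ) : delay k z ∈ Metric.ball (constSeq v) ε := by
  rw [mem_ball_iff_norm] at hz ⊢
  have h : delay k z - constSeq v = delay k (z - constSeq v) := by ext t; simp
  exact h ▸ (norm_delay_le k _).trans_lt hz

lemma isTimeInvariantSet_ball_constSeq (v : X) (ε : ℝ) :
    IsTimeInvariantSet (Metric.ball (constSeq v) ε) := by
  intro k
  refine Set.Subset.antisymm ?_ fun z hz => ?_
  · rintro _ ⟨z, hz, rfl⟩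
    exact delay_mem_ball_constSeq hz k
  rw [mem_ball_iff_norm] at hz
  -- The preimage advances `z` by `k` and fills the last `k` entries with the central value `v`.
  let f : NegInt → X := fun t => if h : t.1 + k ≤ 0 then z ⟨t.1 + k, h⟩ - v else 0
  have hf : ∀ t, ‖f t‖ ≤ ‖z - constSeq v‖ := by
    intro t
    simp only [f]
    split_ifs with h
    · exact lp.norm_apply_le_norm ENNReal.top_ne_zero (z - constSeq v) ⟨t.1 + k, h⟩
    · simp
  let g : LInfMinus X := ⟨f, memℓp_infty ⟨_, by rintro _ ⟨t, rfl⟩; exact hf t⟩⟩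
  refine ⟨g + constSeq v, ?_, ?_⟩
  · rw [mem_ball_iff_norm, add_sub_cancel_right]
    exact (lp.norm_le_of_forall_le (norm_nonneg _) hf).trans_lt hz
  · ext t
    have ht : (t.back k).1 + k = t.1 := by simp [NegInt.back]
    have : f (t.back k) = z t - v := by
      simp only [f, ht]
      rw [dif_pos t.2]
    change f (t.back k) + v = z t
    rw [this, sub_add_cancel]

lemma IsReservoirSolution.delay {F : X × Y → X} {x : LInfMinus X} {z : LInfMinus Y}
    (h : IsReservoirSolution F x z) (k : ℕ) :
    IsReservoirSolution F (_root_.delay k x) (_root_.delay k z) := by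
  intro t
  rw [delay_apply, delay_apply, delay_apply, h (t.back k), NegInt.back_back]

/-- A filter that commutes with the delays is causal: its output at time `t` is the value at time
`0` of its output for the input delayed by `-t`, which only involves the input up to time `t`. -/
lemma IsTimeInvariantFilterOn.isCausalOn {U : LInfMinus Y → LInfMinus X} {V : Set (LInfMinus Y)}
    (h : IsTimeInvariantFilterOn U V) : IsCausalOn U V := by
  intro z hz w hw t hzw
  obtain ⟨k, hk⟩ : ∃ k : ℕ, NegInt.back k ⟨0, le_rfl⟩ = t :=
    ⟨(-t.1).toNat, Subtype.ext (by have := t.2; simp only [NegInt.back]; omega)⟩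
  have hd : _root_.delay k z = _root_.delay k w := by
    ext s
    refine hzw _ (Subtype.coe_le_coe.1 ?_)
    have hk' := congrArg Subtype.val hk
    have := s.2
    simp only [NegInt.back] at hk' ⊢
    omega
  rw [← hk, ← delay_apply, ← delay_apply, ← h.2 k z hz, ← h.2 k w hw, hd]

end

section
variable {X Y : Type*} [NormedAddCommGroup X] [NormedSpace ℝ X]
  [NormedAddCommGroup Y] [NormedSpace ℝ Y]

/-! ### Superposition operators on bounded sequences -/

lemma norm_multilinear_apply_le {n : ℕ} (m : X [×n]→L[ℝ] Y) (v : Fin n → LInfMinus X)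
    (t : NegInt) : ‖m fun i => v i t‖ ≤ ‖m‖ * ∏ i, ‖v i‖ :=
  (m.le_opNorm _).trans <| by
    gcongr with i
    exact lp.norm_apply_le_norm ENNReal.top_ne_zero (v i) t

/-- The action of a continuous multilinear map on bounded sequences, separately at each time. -/
noncomputable def lInfMultilinear {n : ℕ} (m : X [×n]→L[ℝ] Y) : (LInfMinus X) [×n]→L[ℝ] (LInfMinus Y) :=
  MultilinearMap.mkContinuous
    { toFun := fun v => ⟨fun t => m fun i => v i t, memℓp_infty ⟨‖m‖ * ∏ i, ‖v i‖, by
        rintro _ ⟨t, rfl⟩; exact norm_multilinear_apply_le m v t⟩⟩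
      map_update_add' := by
        intro _ v i x y
        ext t
        have h (w : LInfMinus X) : (fun j => Function.update v i w j t)
            = Function.update (fun j => v j t) i (w t) := by
          ext j
          by_cases hj : j = i
          · subst hj; simp
          · simp [hj]
        change m _ = m _ + m _
        rw [h, h, h, lp.coeFn_add, Pi.add_apply, m.map_update_add]
      map_update_smul' := by
        intro _ v i c x
        ext t
        have h (w : LInfMinus X) : (fun j => Function.update v i w j t)
            = Function.update (fun j => v j t) i (w t) := by
          ext j
          by_cases hj : j = i
          · subst hj; simp
          · simp [hj]
        change m _ = c • m _
        rw [h, h, lp.coeFn_smul, Pi.smul_apply, m.map_update_smul] }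
    ‖m‖ fun v => lp.norm_le_of_forall_le (by positivity) (norm_multilinear_apply_le m v)

lemma lInfMultilinear_apply {n : ℕ} (m : X [×n]→L[ℝ] Y) (v : Fin n → LInfMinus X)
    (t : NegInt) : lInfMultilinear m v t = m fun i => v i t := rfl

lemma norm_lInfMultilinear_le {n : ℕ} (m : X [×n]→L[ℝ] Y) : ‖lInfMultilinear m‖ ≤ ‖m‖ :=
  MultilinearMap.mkContinuous_norm_le _ (norm_nonneg _) _

/-- A function analytic at `c` induces an analytic superposition operator near the constant
sequence `c`, whose derivative there is the superposition operator of the derivative. As `N`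
has to be given by `f` near that sequence only, it can be taken to be the sum of the series. -/
lemma exists_analyticAt_superposition [CompleteSpace Y] {f : X → Y} {c : X}
    (hf : AnalyticAt ℝ f c) :
    ∃ N : LInfMinus X → LInfMinus Y, AnalyticAt ℝ N (constSeq c) ∧
      (∀ᶠ w in nhds (constSeq c), ∀ t, N w t = f (w t)) ∧
      ∀ w t, fderiv ℝ N (constSeq c) w t = fderiv ℝ f c (w t) := by
  obtain ⟨p, r, hp⟩ := hf
  let P : FormalMultilinearSeries ℝ (LInfMinus X) (LInfMinus Y) := fun n => lInfMultilinear (p n)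
  have hrad : p.radius ≤ P.radius := by
    refine ENNReal.le_of_forall_nnreal_lt fun s hs => ?_
    obtain ⟨C, -, hC⟩ := p.norm_mul_pow_le_of_lt_radius hs
    refine P.le_radius_of_bound C fun n => le_trans ?_ (hC n)
    gcongr
    exact norm_lInfMultilinear_le (p n)
  have hpos : 0 < P.radius := hp.r_pos.trans_le (hp.r_le.trans hrad)
  have hP : HasFPowerSeriesOnBall (fun w => P.sum (w - constSeq c)) P (constSeq c) P.radius := by
    simpa using (P.hasFPowerSeriesOnBall hpos).comp_sub (constSeq c)
  refine ⟨_, hP.analyticAt, ?_, fun w t => ?_⟩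
  · filter_upwards [Metric.eball_mem_nhds (constSeq c) hp.r_pos] with w hw t
    have h₁ := hP.hasSum_sub (Metric.eball_subset_eball (hp.r_le.trans hrad) hw)
    have h₂ := h₁.mapL (lp.evalCLM ℝ (fun _ : NegInt => Y) ∞ t)
    have hwt : w t ∈ Metric.eball c r := by
      rw [Metric.mem_eball] at hw ⊢
      refine lt_of_le_of_lt ?_ hw
      rw [edist_eq_enorm_sub, edist_eq_enorm_sub, ← ofReal_norm, ← ofReal_norm]
      exact ENNReal.ofReal_le_ofReal
        (lp.norm_apply_le_norm ENNReal.top_ne_zero (w - constSeq c) t)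
    exact h₂.unique (hp.hasSum_sub hwt)
  · rw [hP.hasFPowerSeriesAt.hasStrictFDerivAt.hasFDerivAt.fderiv,
      hp.hasFPowerSeriesAt.hasStrictFDerivAt.hasFDerivAt.fderiv]
    simp only [continuousMultilinearCurryFin1_apply, P, lInfMultilinear_apply]
    congr 1

/-! ### The state equation near the constant solution -/

/-- The linear map `(z, x) ↦ (t ↦ (x (t - 1), z t))` that collects the arguments of the state
equation. -/
noncomputable def stateInput (X Y : Type*) [NormedAddCommGroup X] [NormedSpace ℝ X]
    [NormedAddCommGroup Y] [NormedSpace ℝ Y] :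
    LInfMinus Y × LInfMinus X →L[ℝ] LInfMinus (X × Y) :=
  have key (v : LInfMinus Y × LInfMinus X) (t : NegInt) :
      ‖((v.2 (t.back 1), v.1 t) : X × Y)‖ ≤ 1 * ‖v‖ := by
    rw [one_mul]
    exact max_le
      ((lp.norm_apply_le_norm ENNReal.top_ne_zero v.2 (t.back 1)).trans (norm_snd_le v))
      ((lp.norm_apply_le_norm ENNReal.top_ne_zero v.1 t).trans (norm_fst_le v))
  LinearMap.mkContinuous
    { toFun := fun v => ⟨fun t => (v.2 (t.back 1), v.1 t), memℓp_infty ⟨1 * ‖v‖, by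
        rintro _ ⟨t, rfl⟩; exact key v t⟩⟩
      map_add' := fun _ _ => rfl
      map_smul' := fun _ _ => rfl }
    1 fun v => lp.norm_le_of_forall_le (by positivity) (key v)

lemma stateInput_apply (v : LInfMinus Y × LInfMinus X) (t : NegInt) :
    stateInput X Y v t = (v.2 (t.back 1), v.1 t) := rfl

/-- Near a constant solution at which `‖D_xF‖ < 1`, the solutions of the reservoir system form the
graph of an analytic function of the input. -/
lemma exists_analyticAt_forall_isReservoirSolution_iff [CompleteSpace X] [CompleteSpace Y]
    {F : X × Y → X} {x₀ : X} {z₀ : Y} (hF : AnalyticAt ℝ F (x₀, z₀)) (hfix : x₀ = F (x₀, z₀))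
    (hpers : ‖fderiv ℝ (fun x : X => F (x, z₀)) x₀‖ < 1) :
    ∃ ψ : LInfMinus Y → LInfMinus X, AnalyticAt ℝ ψ (constSeq z₀) ∧
      ψ (constSeq z₀) = constSeq x₀ ∧
      ∀ᶠ v in nhds (constSeq z₀, constSeq x₀),
        IsReservoirSolution F v.2 v.1 ↔ ψ v.1 = v.2 := by
  obtain ⟨N, hN, hNF, hN'⟩ := exists_analyticAt_superposition hF
  set u : LInfMinus Y × LInfMinus X := (constSeq z₀, constSeq x₀)
  have hSu : stateInput X Y u = constSeq (x₀, z₀) := rfl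
  rw [← hSu] at hN hNF hN'
  let Ψ : LInfMinus Y × LInfMinus X → LInfMinus X := fun v => v.2 - N (stateInput X Y v)
  have hΨ : ContDiffAt ℝ ⊤ Ψ u :=
    (analyticAt_snd.sub (hN.comp ((stateInput X Y).analyticAt u))).contDiffAt
  have hNS : ∀ᶠ v in nhds u, ∀ t, N (stateInput X Y v) t = F (stateInput X Y v t) :=
    (stateInput X Y).continuous.continuousAt.eventually hNF
  have hΨ0 : Ψ u = 0 := by
    ext t
    have := hNS.self_of_nhds t
    simp only [stateInput_apply] at this
    simp [Ψ, this, u, ← hfix]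
  -- `T` is the derivative at `u` of the right-hand side of the state equation in the state.
  let T : LInfMinus X →L[ℝ] LInfMinus X :=
    fderiv ℝ N (stateInput X Y u) ∘L stateInput X Y ∘L .inr ℝ _ _
  have hΨ' : fderiv ℝ Ψ u ∘L .inr ℝ _ _ = 1 - T := by
    have h := (hasFDerivAt_snd (𝕜 := ℝ) (p := u)).sub
      (hN.differentiableAt.hasFDerivAt.comp u (stateInput X Y).hasFDerivAt)
    have h' : HasFDerivAt Ψ _ u := h
    rw [h'.fderiv]
    ext x t
    simp [T]
  have hpart : ∀ x : X, fderiv ℝ F (x₀, z₀) (x, 0) = fderiv ℝ (fun x : X => F (x, z₀)) x₀ x := by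
    intro x
    have h := HasFDerivAt.comp (f := fun x : X => (x, z₀)) x₀ hF.differentiableAt.hasFDerivAt
      (hasFDerivAt_prodMk_left x₀ z₀)
    have h' : HasFDerivAt (fun x : X => F (x, z₀)) _ x₀ := h
    rw [h'.fderiv]
    simp
  have hT : ‖T‖ < 1 := by
    refine lt_of_le_of_lt (T.opNorm_le_bound (norm_nonneg _) fun x => ?_) hpers
    refine lp.norm_le_of_forall_le (by positivity) fun t => ?_
    have : T x t = fderiv ℝ (fun x : X => F (x, z₀)) x₀ (x (t.back 1)) := by
      rw [← hpart]
      exact hN' _ t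
    rw [this]
    exact (ContinuousLinearMap.le_opNorm _ _).trans <| by
      gcongr
      exact lp.norm_apply_le_norm ENNReal.top_ne_zero x (t.back 1)
  have hinv : (fderiv ℝ Ψ u ∘L .inr ℝ _ _).IsInvertible := by
    rw [hΨ']
    exact ⟨ContinuousLinearEquiv.unitsEquiv ℝ _ (Units.oneSub T hT), rfl⟩
  refine ⟨hΨ.implicitFunction (by simp) hinv,
    (hΨ.contDiffAt_implicitFunction (by simp) hinv).analyticAt,
    hΨ.implicitFunction_apply_self (by simp) hinv, ?_⟩
  filter_upwards [hΨ.eventually_apply_eq_iff_implicitFunction (by simp) hinv, hNS] with v hv hNv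
  rw [← hv, hΨ0, sub_eq_zero]
  refine ⟨fun h => ?_, fun h t => ?_⟩
  · ext t
    rw [hNv]
    exact h t
  · rw [h, hNv, stateInput_apply, ← h]

/-! ### Power series on a small ball -/

/-- If the power series of `f` at `c` converges on the ball of radius `r`, its power series at any
point of the ball of radius `δ ≤ r / 3` converges to `f` on all of that smaller ball. -/
lemma HasFPowerSeriesOnBall.hasPowerSeriesThroughout_ball [CompleteSpace Y] {f : X → Y}
    {p : FormalMultilinearSeries ℝ X Y} {c : X} {r : ℝ≥0∞} (h : HasFPowerSeriesOnBall f p c r)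
    {δ : ℝ} (hδ : 3 * ENNReal.ofReal δ ≤ r) :
    HasPowerSeriesThroughout f (Metric.ball c δ) := by
  intro y hy
  rw [mem_ball_iff_norm] at hy
  have hpos : 0 < δ := (norm_nonneg _).trans_lt hy
  have hδr : ENNReal.ofReal (3 * δ) ≤ r := by
    rwa [ENNReal.ofReal_mul (by norm_num), ENNReal.ofReal_ofNat]
  have hn : ((‖y - c‖₊ : NNReal) : ℝ≥0∞) = ENNReal.ofReal ‖y - c‖ := (ofReal_norm _).symm
  have hyr : ((‖y - c‖₊ : NNReal) : ℝ≥0∞) < r := by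
    rw [hn]
    exact ((ENNReal.ofReal_lt_ofReal_iff (by positivity)).2 (by linarith)).trans_le hδr
  have hq := h.changeOrigin hyr
  rw [add_sub_cancel] at hq
  refine ⟨_, hq.hasFPowerSeriesAt, fun w hw => hq.hasSum_sub ?_⟩
  rw [mem_ball_iff_norm] at hw
  rw [Metric.mem_eball, edist_eq_enorm_sub, lt_tsub_iff_right, hn, ← ofReal_norm,
    ← ENNReal.ofReal_add (norm_nonneg _) (norm_nonneg _)]
  refine ((ENNReal.ofReal_lt_ofReal_iff (by positivity)).2 ?_).trans_le hδr
  have : ‖w - y‖ ≤ ‖w - c‖ + ‖y - c‖ := by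
    simpa using norm_sub_le (w - c) (y - c)
  linarith

end

theorem mainTheorem7
    {E G : Type*} [NormedAddCommGroup E] [NormedSpace ℝ E] [FiniteDimensional ℝ E]
    [NormedAddCommGroup G] [NormedSpace ℝ G] [FiniteDimensional ℝ G]
    (F : E × G → E) (hF : AnalyticOnNhd ℝ F Set.univ)
    (x₀ : E) (z₀ : G) (hfix : x₀ = F (x₀, z₀))
    (hbound : ∀ r : ℕ, 1 ≤ r → BddAbove (Set.range fun p : E × G => ‖iteratedFDeriv ℝ r F p‖))
    (hpers : ‖fderiv ℝ (fun x : E => F (x, z₀)) x₀‖ < 1) :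
    ∃ (Vx : Set (LInfMinus E)) (Vz : Set (LInfMinus G)),
      IsOpen Vx ∧ IsTimeInvariantSet Vx ∧ constSeq x₀ ∈ Vx ∧
      IsOpen Vz ∧ IsTimeInvariantSet Vz ∧ constSeq z₀ ∈ Vz ∧
      HasESP F Vz Vx ∧
      ∃ U : LInfMinus G → LInfMinus E,
        IsReservoirFilter F Vz Vx U ∧
        (∀ U' : LInfMinus G → LInfMinus E, IsReservoirFilter F Vz Vx U' → Set.EqOn U' U Vz) ∧
        IsCausalOn U Vz ∧ IsTimeInvariantFilterOn U Vz ∧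
        AnalyticOnNhd ℝ U Vz ∧ HasPowerSeriesThroughout U Vz ∧ ContinuousOn U Vz := by
  have : CompleteSpace E := FiniteDimensional.complete ℝ E
  have : CompleteSpace G := FiniteDimensional.complete ℝ G
  obtain ⟨ψ, hψ, hψ0, hiff⟩ :=
    exists_analyticAt_forall_isReservoirSolution_iff (hF _ (Set.mem_univ _)) hfix hpers
  obtain ⟨p, r, hp⟩ := hψ
  obtain ⟨ε, hε, hball⟩ := Metric.eventually_nhds_iff_ball.1 hiff
  have hψV : ∀ᶠ z in nhds (constSeq z₀), ψ z ∈ Metric.ball (constSeq x₀) ε :=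
    hp.analyticAt.continuousAt (hψ0 ▸ Metric.ball_mem_nhds _ hε)
  obtain ⟨ε', hε', hψε'⟩ := Metric.eventually_nhds_iff_ball.1 hψV
  obtain ⟨ρ, hρ, hρr⟩ := ENNReal.lt_iff_exists_nnreal_btwn.1 hp.r_pos
  have hρ0 : (0 : ℝ) < ρ := by exact_mod_cast hρ
  -- The bounds `ε` and `ε'` are for the solutions, `ρ / 3` for the power series.
  obtain ⟨δ, hδ, hδε, hδε', hδρ⟩ : ∃ δ : ℝ, 0 < δ ∧ δ ≤ ε ∧ δ ≤ ε' ∧ δ ≤ ρ / 3 :=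
    ⟨min ε (min ε' (ρ / 3)), by positivity, by simp, by simp, by simp⟩
  have hmaps : ∀ z ∈ Metric.ball (constSeq z₀) δ, ψ z ∈ Metric.ball (constSeq x₀) ε :=
    fun z hz => hψε' z (Metric.ball_subset_ball hδε' hz)
  have hsol : ∀ z ∈ Metric.ball (constSeq z₀) δ, ∀ x ∈ Metric.ball (constSeq x₀) ε,
      (IsReservoirSolution F x z ↔ ψ z = x) := fun z hz x hx =>
    hball (z, x) (by
      rw [← ball_prod_same]
      exact ⟨Metric.ball_subset_ball hδε hz, hx⟩)
  have hψsol : ∀ z ∈ Metric.ball (constSeq z₀) δ, IsReservoirSolution F (ψ z) z :=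
    fun z hz => (hsol z hz _ (hmaps z hz)).2 rfl
  have hti : IsTimeInvariantFilterOn ψ (Metric.ball (constSeq z₀) δ) :=
    ⟨isTimeInvariantSet_ball_constSeq z₀ δ, fun k z hz =>
      (hsol _ (delay_mem_ball_constSeq hz k) _ (delay_mem_ball_constSeq (hmaps z hz) k)).1
        ((hψsol z hz).delay k)⟩
  have hthrough : HasPowerSeriesThroughout ψ (Metric.ball (constSeq z₀) δ) := by
    refine hp.hasPowerSeriesThroughout_ball (le_trans ?_ hρr.le)
    rw [← ENNReal.ofReal_ofNat, ← ENNReal.ofReal_mul (by norm_num), ← ENNReal.ofReal_coe_nnreal]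
    exact ENNReal.ofReal_le_ofReal (by linarith)
  have han : AnalyticOnNhd ℝ ψ (Metric.ball (constSeq z₀) δ) := fun z hz =>
    let ⟨_, hq, _⟩ := hthrough z hz
    hq.analyticAt
  exact ⟨Metric.ball (constSeq x₀) ε, Metric.ball (constSeq z₀) δ,
    Metric.isOpen_ball, isTimeInvariantSet_ball_constSeq _ _, Metric.mem_ball_self hε,
    Metric.isOpen_ball, isTimeInvariantSet_ball_constSeq _ _, Metric.mem_ball_self hδ,
    fun z hz => ⟨ψ z, ⟨hmaps z hz, hψsol z hz⟩, fun x hx => ((hsol z hz x hx.1).1 hx.2).symm⟩,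
    ψ, ⟨hmaps, hψsol⟩, fun U' hU' z hz => ((hsol z hz _ (hU'.1 hz)).1 (hU'.2 z hz)).symm,
    hti.isCausalOn, hti, han, hthrough, han.continuousOn⟩
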